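/- **Setting.** All logarithms are to base $2$. Inputs are $x\in\{1,2\}$, outputs are $a\in\{+1,-1\}$, and $|A|=2$ is the number of outputs. Vectors in $\mathbb R^2$ are compared componentwise. *Quantum behaviours.* An energy observable on a complex Hilbert space is an observable $O$ (possibly unbounded) with an orthonormal basis of eigenvectors, whose lowest eigenvalue is $0$ and non-degenerate and whose other eigenvalues are all $\ge 1$. $\mathcal Q\subset\mathbb R^4$ is the convex hull of the set of all $(\vec E,\vec\omega)=(E_1,E_2,\omega_1,\omega_2)$ for which there are a Hilbert space, density operators $\rho_1,\rho_2$, an observable $-1\le M\le 1$ and an energy observable $O$ on it with $\operatorname{Tr}[\rho_xM]=E_x$ and $\operatorname{Tr}[\rho_xO]\le\omega_x$ for $x=1,2$. For $\vec\omega_{\rm pk}\in\mathbb R^2$ let $\mathcal Q_{\vec\omega_{\rm pk}}=\{(\vec E,\vec\omega)\in\mathcal Q:\vec\omega\le\vec\omega_{\rm pk}\}$. *Trade-off functions.* Let $p$ be a probability distribution on $\{1,2\}$ with $p(1),p(2)>0$, and let $H(\vec E)=-\sum_{a,x}p(x)\frac{1+aE_x}2\log\frac{1+aE_x}2$. A triple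 $(\vec\alpha,\vec\beta,\vec\gamma)\in(\mathbb R^2)^3$ is a trade-off function with max-peak energies $\vec\omega_{\rm pk}$ if $\vec\gamma\le 0$ and $\alpha_1+\alpha_2+\vec\beta\cdot\vec E+\vec\gamma\cdot\vec\omega\le H(\vec E)$ for all $(\vec E,\vec\omega)\in\mathcal Q_{\vec\omega_{\rm pk}}$. Put $\xi(a,x)=\frac{1}{p(x)}(\alpha_x+a\beta_x)$, $\xi^+=\max_{a,x}\xi(a,x)$, $\xi^-=\min_{a,x}\xi(a,x)$, $\bar\gamma=\gamma_1+\gamma_2$. *The $n$-round model.* Let $n\ge1$, and let $A^n=(A_1,\dots,A_n)$, $X^n=(X_1,\dots,X_n)$ and $\Lambda$ (with values in an arbitrary measurable space) be random variables with joint law $\mu$; let $W_i=(A_1,\dots,A_{i-1},X_1,\dots,X_{i-1})$. Let $\vec\omega_{\rm pk}\le(1,1)$, $\vec\omega_{\rm avg}\in\mathbb R^2$ and $\epsilon_\omega\ge0$. Assume that there are measurable functions $\vec E_i,\vec\omega_i$ of $(W_i,\Lambda)$ such that, for all $i$ and almost surely, 1. $\mu(X_i=x\mid W_i,\Lambda)=p(x)$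 for all $x$; 2. $(\vec E_i(W_i,\Lambda),\vec\omega_i(W_i,\Lambda))\in\mathcal Q$ and $\mu(A_i=a\mid X_i=x,W_i,\Lambda)=\frac12\bigl(1+aE_{i,x}(W_i,\Lambda)\bigr)$; 3. $\vec\omega_i(W_i,\Lambda)\le\vec\omega_{\rm pk}$; and that 4. $\Pr\bigl(\frac1n\sum_{i=1}^n\vec\omega_i(W_i,\Lambda)\le\vec\omega_{\rm avg}\bigr)\ge1-\epsilon_\omega$. **Theorem.** Let $\epsilon_t>0$, let $\mu$ be as above, and let $(\vec\alpha,\vec\beta,\vec\gamma)$ be a trade-off function with max-peak energies $\vec\omega_{\rm pk}$. Let $$t=\sqrt{2V}\sqrt{\frac{\log(1/\epsilon_t)}n}+\frac{\xi^+}3\,\frac{\log(1/\epsilon_t)}n,$$ $$V=\max\{(\xi^++\bar\gamma)^2,(\xi^-+\bar\gamma)^2\}+2\max\{-\log|A|\,(\bar\gamma+\xi^-),0\}+\frac{4|A|}{e^2}(\log_2e)^2,$$ and assume that $t\ge0$ (which is automatic if $\xi^+\ge0$ and $\epsilon_t\le1$). Then, with probability at least $1-\epsilon_\omega-\epsilon_t$,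 $$-\frac1n\log\mu(A^n\mid X^n,\Lambda)\;\ge\;\frac1n\sum_{i=1}^n\xi(A_i,X_i)+\vec\gamma\cdot\vec\omega_{\rm avg}-t .$$ -/

import Mathlib

open MeasureTheory ProbabilityTheory

namespace SemiDI

/-! ### Quantum behaviours

Inputs `x ∈ {1,2}` are modelled by `Fin 2`; outputs `a ∈ {+1,-1}` by `Bool` through `sgn`. -/

section Quantum

variable {H : Type} [NormedAddCommGroup H] [InnerProductSpace ℂ H] [CompleteSpace H]

/-- `Tr T = c`: in every orthonormal (Hilbert) basis the diagonal of `T` sums unconditionally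
to `c`. -/
def HasTrace (T : H →L[ℂ] H) (c : ℂ) : Prop :=
  ∀ (ι : Type) (b : HilbertBasis ι ℂ H), HasSum (fun i => inner ℂ (b i) (T (b i))) c

/-- A quantum state: a positive operator of trace one. -/
def IsState (ρ : H →L[ℂ] H) : Prop :=
  ρ.IsPositive ∧ HasTrace ρ 1

/-- An energy observable `O = ∑ i, eig i |b i⟩⟨b i|` (possibly unbounded), given by an orthonormal
basis of eigenvectors `b` and the corresponding eigenvalues: the lowest eigenvalue is `0`, it is
non-degenerate (its only eigenvector is `b vac`), and all other eigenvalues are at least `1`. -/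
structure EnergyObservable (H : Type) [NormedAddCommGroup H] [InnerProductSpace ℂ H]
    [CompleteSpace H] where
  /-- index set of the eigenbasis -/
  ι : Type
  /-- orthonormal basis of eigenvectors -/
  basis : HilbertBasis ι ℂ H
  /-- eigenvalues -/
  eig : ι → ℝ
  /-- index of the vacuum -/
  vac : ι
  eig_vac : eig vac = 0
  one_le_eig : ∀ i, i ≠ vac → 1 ≤ eig i

/-- `Tr[ρ O] ≤ w`: the mean energy `∑ i, eig i ⟨b i|ρ|b i⟩` is finite and at most `w`. -/
def EnergyObservable.MeanLE (O : EnergyObservable H) (ρ : H →L[ℂ] H) (w : ℝ) : Prop :=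
  ∃ s : ℝ, HasSum (fun i => O.eig i * (inner ℂ (O.basis i) (ρ (O.basis i))).re) s ∧ s ≤ w

end Quantum

/-- A behaviour `(E, ω)`: correlations `E = (E₁, E₂)` and energy bounds `ω = (ω₁, ω₂)`. -/
abbrev Behaviour : Type := (Fin 2 → ℝ) × (Fin 2 → ℝ)

/-- `(E, ω)` is realized, without shared randomness, by two states `ρ₁, ρ₂`, an observable
`-1 ≤ M ≤ 1` and an energy observable `O` on some complex Hilbert space:
`Tr[ρ_x M] = E_x` and `Tr[ρ_x O] ≤ ω_x`. -/
def IsRealizable (q : Behaviour) : Prop :=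
  ∃ (H : Type) (_ : NormedAddCommGroup H) (_ : InnerProductSpace ℂ H) (_ : CompleteSpace H)
    (ρ : Fin 2 → H →L[ℂ] H) (M : H →L[ℂ] H) (O : EnergyObservable H),
    (∀ x, IsState (ρ x)) ∧ IsSelfAdjoint M ∧ -1 ≤ M ∧ M ≤ 1 ∧
    (∀ x, HasTrace (ρ x * M) ((q.1 x : ℝ) : ℂ)) ∧
    (∀ x, O.MeanLE (ρ x) (q.2 x))

/-- The quantum set `𝒬`: convex combinations of realizable behaviours. -/
def quantumSet : Set Behaviour := convexHull ℝ {q | IsRealizable q}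

/-- The set `𝒬_pk` of quantum behaviours with energies bounded by `ωpk`. -/
def quantumSetPeak (ωpk : Fin 2 → ℝ) : Set Behaviour := {q | q ∈ quantumSet ∧ q.2 ≤ ωpk}

/-! ### Entropy, trade-off functions and the error term (all logarithms in base two) -/

noncomputable section

/-- The value `±1` of an output. -/
def sgn (a : Bool) : ℝ := if a then 1 else -1

/-- `p(a|x) = (1 + a E_x) / 2`. -/
def outProb (E : Fin 2 → ℝ) (a : Bool) (x : Fin 2) : ℝ := (1 + sgn a * E x) / 2

/-- The conditional Shannon entropy `H(E)`, for the input distribution `p`. -/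
def entropy (p : Fin 2 → ℝ) (E : Fin 2 → ℝ) : ℝ :=
  -∑ a : Bool, ∑ x : Fin 2, p x * outProb E a x * Real.logb 2 (outProb E a x)

/-- `(α, β, γ)` is a trade-off function with max-peak energies `ωpk`. -/
def IsTradeoffFunction (p ωpk α β γ : Fin 2 → ℝ) : Prop :=
  γ ≤ 0 ∧ ∀ q ∈ quantumSetPeak ωpk,
    ∑ x, α x + ∑ x, β x * q.1 x + ∑ x, γ x * q.2 x ≤ entropy p q.1

/-- The estimator `ξ(a,x) = (α_x + a β_x) / p(x)`. -/
def xi (p α β : Fin 2 → ℝ) (a : Bool) (x : Fin 2) : ℝ := (α x + sgn a * β x) / p x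

/-- `ξ⁺ = max_{a,x} ξ(a,x)`. -/
def xiMax (p α β : Fin 2 → ℝ) : ℝ := ⨆ q : Bool × Fin 2, xi p α β q.1 q.2

/-- `ξ⁻ = min_{a,x} ξ(a,x)`. -/
def xiMin (p α β : Fin 2 → ℝ) : ℝ := ⨅ q : Bool × Fin 2, xi p α β q.1 q.2

/-- The variance bound `V`; the number `|A|` of outputs is `Fintype.card Bool`. -/
def varBound (p α β γ : Fin 2 → ℝ) : ℝ :=
  max ((xiMax p α β + ∑ x, γ x) ^ 2) ((xiMin p α β + ∑ x, γ x) ^ 2)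
    + 2 * max (-(Real.logb 2 (Fintype.card Bool) * (∑ x, γ x + xiMin p α β))) 0
    + 4 * (Fintype.card Bool : ℝ) / Real.exp 1 ^ 2 * Real.logb 2 (Real.exp 1) ^ 2

/-- The error term `t`. -/
def errorTerm (n : ℕ) (p α β γ : Fin 2 → ℝ) (εt : ℝ) : ℝ :=
  √(2 * varBound p α β γ) * √(Real.logb 2 (1 / εt) / n)
    + xiMax p α β / 3 * (Real.logb 2 (1 / εt) / n)

/-! ### The `n`-round model -/

/-- The conditional probability `μ(Y | Z)` as a random variable: the regular conditional
probability, given the actual value of `Z`, that `Y = y`. -/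
def condProb {Ω S T : Type*} [MeasurableSpace Ω] [MeasurableSpace S] [StandardBorelSpace S]
    [Nonempty S] [MeasurableSpace T] (μ : Measure Ω) [IsFiniteMeasure μ]
    (Y : Ω → S) (Z : Ω → T) (y : S) (ω : Ω) : ℝ :=
  (condDistrib Y Z μ (Z ω)).real {y}

/-- The past `W_i = (A^{i-1}, X^{i-1})`: outputs and inputs of all rounds before round `i`. -/
def past {Ω : Type*} {n : ℕ} (A : Fin n → Ω → Bool) (X : Fin n → Ω → Fin 2) (i : Fin n) (ω : Ω) :
    Fin i.val → Bool × Fin 2 :=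
  fun j => (A (Fin.castLE i.isLt.le j) ω, X (Fin.castLE i.isLt.le j) ω)

/-- The assumptions on the joint distribution of the outputs `A`, the inputs `X` and the
adversary's information `Λ`, with `E i w l` and `en i w l` the correlations and the energies of the
device at round `i` when the past is `w` and the adversary's information is `l`. -/
structure NRoundModel {Ω L : Type*} [MeasurableSpace Ω] [MeasurableSpace L]
    (μ : Measure Ω) [IsProbabilityMeasure μ] {n : ℕ}
    (A : Fin n → Ω → Bool) (X : Fin n → Ω → Fin 2) (Λ : Ω → L)
    (E en : (i : Fin n) → (Fin i.val → Bool × Fin 2) → L → Fin 2 → ℝ)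
    (p ωpk ωavg : Fin 2 → ℝ) (εω : ℝ) : Prop where
  measurable_A : ∀ i, Measurable (A i)
  measurable_X : ∀ i, Measurable (X i)
  measurable_Λ : Measurable Λ
  measurable_E : ∀ i w, Measurable (E i w)
  measurable_en : ∀ i w, Measurable (en i w)
  /-- `X_i` has law `p` conditionally on the past and on `Λ`. -/
  input : ∀ i x, ∀ᵐ ω ∂μ, condProb μ (X i) (fun ω => (past A X i ω, Λ ω)) x ω = p x
  /-- The behaviour of the device at each round is quantum. -/
  quantum : ∀ i, ∀ᵐ ω ∂μ, (E i (past A X i ω) (Λ ω), en i (past A X i ω) (Λ ω)) ∈ quantumSet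
  /-- The output `A_i` is produced by that behaviour on input `X_i`. -/
  output : ∀ i a, ∀ᵐ ω ∂μ,
    condProb μ (A i) (fun ω => (X i ω, past A X i ω, Λ ω)) a ω
      = outProb (E i (past A X i ω) (Λ ω)) a (X i ω)
  /-- Max-peak assumption. -/
  peak : ∀ i, ∀ᵐ ω ∂μ, en i (past A X i ω) (Λ ω) ≤ ωpk
  /-- Max-average assumption. -/
  average : 1 - εω ≤
    μ.real {ω | ∀ x, (1 / (n : ℝ)) * ∑ i, en i (past A X i ω) (Λ ω) x ≤ ωavg x}

end

end SemiDI

/-!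
Give the round with output `a` and input `x` the score `ξ(a,x) + γ · ω + log p(a|x)`. Conditionally
on the past, its mean is the amount by which the trade-off inequality fails, hence nonpositive.
Adding the constant `γ₁ + γ₂ - γ · ω`, known from the past, turns the score into
`ξ(a,x) + γ₁ + γ₂ + log p(a|x)`, which is at most `ξ⁺` and has second moment at most `V`. The shift
cancels in the exponential moment of the score, so Bernstein's inequality holds for the total score
with precisely these two constants. It needs `ξ⁺ ≥ 0`; otherwise the total score is almost surely at
most `n ξ⁺ ≤ 0 ≤ n t`, as energies are nonnegative.

Each input is independent of everything before it, so conditioning on all inputs and on `Λ` still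
lets the probability of the outputs factorise: `log μ(Aⁿ|Xⁿ,Λ)` is the sum of the `log p(aᵢ|xᵢ)`.
Thus a bound on the total score is a bound on the surprisal, with energies replaced by their
averages because `γ ≤ 0`.
-/

open scoped ENNReal

namespace SemiDI

section Analysis

lemma one_sub_div_three_mul_exp_le (z : ℝ) :
    (1 - z / 3) * (Real.exp z - 1 - z) ≤ z ^ 2 / 2 := by
  let f : ℝ → ℝ := fun z => z ^ 2 / 2 - (1 - z / 3) * (Real.exp z - 1 - z)
  let f' : ℝ → ℝ := fun z => (z + 2 + Real.exp z * (z - 2)) / 3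
  let f'' : ℝ → ℝ := fun z => (1 - Real.exp z * (1 - z)) / 3
  have hf : ∀ z, HasDerivAt f (f' z) z := fun z => by
    refine ((((hasDerivAt_id' z).pow 2).div_const 2).sub
      ((((hasDerivAt_id' z).div_const 3).const_sub 1).mul
        (((Real.hasDerivAt_exp z).sub_const 1).sub (hasDerivAt_id' z)))).congr_deriv ?_
    simp only [f', Pi.sub_apply]
    push_cast
    ring
  have hf' : ∀ z, HasDerivAt f' (f'' z) z := fun z => by
    refine ((((hasDerivAt_id' z).add_const 2).add
      ((Real.hasDerivAt_exp z).mul ((hasDerivAt_id' z).sub_const 2))).div_const 3).congr_deriv ?_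
    simp only [f'']
    ring
  have hf'' : ∀ z, 0 ≤ f'' z := fun z => by
    have h : Real.exp z * (1 - z) ≤ Real.exp z * Real.exp (-z) := by
      gcongr
      exact Real.one_sub_le_exp_neg z
    rw [← Real.exp_add, add_neg_cancel, Real.exp_zero] at h
    simp only [f'']
    linarith
  have hmono : Monotone (deriv f) := by
    rw [funext fun z => (hf z).deriv]
    exact monotone_of_hasDerivAt_nonneg hf' hf''
  have hconv := hmono.convexOn_univ_of_deriv fun z => (hf z).differentiableAt
  have hmin : f 0 ≤ f z :=
    hconv.isMinOn_of_rightDeriv_eq_zero (by simp)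
      (by simp [(hf 0).hasDerivWithinAt.derivWithin (uniqueDiffWithinAt_Ioi 0), f'])
      (Set.mem_univ z)
  simp [f] at hmin
  linarith

lemma exp_le_one_add_add_sq_div {z x : ℝ} (hzx : z ≤ x) (hx : x < 3) :
    Real.exp z ≤ 1 + z + z ^ 2 / (2 * (1 - x / 3)) := by
  have hx' : 0 < 1 - x / 3 := by linarith
  have h0 : 0 ≤ Real.exp z - 1 - z := by linarith [Real.add_one_le_exp z]
  have h : Real.exp z - 1 - z ≤ z ^ 2 / (2 * (1 - x / 3)) := by
    rw [le_div_iff₀ (by positivity)]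
    calc (Real.exp z - 1 - z) * (2 * (1 - x / 3))
        ≤ (Real.exp z - 1 - z) * (2 * (1 - z / 3)) := by gcongr
      _ = 2 * ((1 - z / 3) * (Real.exp z - 1 - z)) := by ring
      _ ≤ z ^ 2 := by linarith [one_sub_div_three_mul_exp_le z]
  linarith

lemma mul_logb_sq_le (b : ℝ) {q : ℝ} (hq0 : 0 ≤ q) (hq1 : q ≤ 1) :
    q * Real.logb b q ^ 2 ≤ 4 / Real.exp 1 ^ 2 * Real.logb b (Real.exp 1) ^ 2 := by
  have hlog : q * Real.log q ^ 2 ≤ 4 / Real.exp 1 ^ 2 := by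
    rcases hq0.eq_or_lt with rfl | hq
    · simp only [zero_mul]
      positivity
    obtain ⟨y, rfl⟩ : ∃ y, q = Real.exp (-y) ^ 2 :=
      ⟨-Real.log q / 2, by rw [← Real.exp_nat_mul]; push_cast; ring_nf; rw [Real.exp_log hq]⟩
    have hy : 0 ≤ y := by
      by_contra hy
      have := (pow_le_one_iff_of_nonneg (Real.exp_nonneg _) two_ne_zero).1 hq1
      rw [Real.exp_le_one_iff] at this
      linarith
    calc Real.exp (-y) ^ 2 * Real.log (Real.exp (-y) ^ 2) ^ 2
        = 4 * (y * Real.exp (-y)) ^ 2 := by rw [Real.log_pow, Real.log_exp]; push_cast; ring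
      _ ≤ 4 * Real.exp (-1) ^ 2 := by
        gcongr
        exact Real.mul_exp_neg_le_exp_neg_one y
      _ = 4 / Real.exp 1 ^ 2 := by rw [Real.exp_neg, inv_pow, div_eq_mul_inv]
  calc q * Real.logb b q ^ 2 = q * Real.log q ^ 2 * Real.logb b (Real.exp 1) ^ 2 := by
        rw [Real.logb, Real.logb, Real.log_exp]; ring
    _ ≤ _ := by gcongr

lemma add_sq_le_of_mem_Icc {m M x l : ℝ} (hx : x ∈ Set.Icc m M) (hl : l ≤ 0) :
    (x + l) ^ 2 ≤ max (M ^ 2) (m ^ 2) + 2 * max (-m) 0 * -l + l ^ 2 := by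
  have hsq : x ^ 2 ≤ max (M ^ 2) (m ^ 2) := by
    rcases le_total 0 x with h0 | h0
    · exact le_max_of_le_left (pow_le_pow_left₀ h0 hx.2 2)
    · exact le_max_of_le_right (by nlinarith [hx.1])
  have hcross : -x * -l ≤ max (-m) 0 * -l := by
    gcongr
    · linarith
    · exact le_max_of_le_left (neg_le_neg hx.1)
  linarith [add_sq x l]

end Analysis

section Bernstein

variable {S : Type*} [Fintype S] {P Z : S → ℝ} {v b c r : ℝ}

/-- `P` is a probability vector under which `Z` satisfies the hypotheses of Bernstein's inequality:
nonpositive mean and, up to a shift, second moment at most `v ^ 2` and upper bound `b`. The shift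
lets both bounds be stated for a simpler variable than `Z` itself. -/
structure BernsteinCondition (P Z : S → ℝ) (v b : ℝ) : Prop where
  nonneg : ∀ s, 0 ≤ P s
  sum_eq_one : ∑ s, P s = 1
  mean_nonpos : ∑ s, P s * Z s ≤ 0
  exists_shift : ∃ k, ∑ s, P s * (Z s + k) ^ 2 ≤ v ^ 2 ∧ ∀ s, Z s + k ≤ b

lemma BernsteinCondition.sum_mul_exp_le (h : BernsteinCondition P Z v b) (hc : 0 ≤ c)
    (hcb : c * b < 3) :
    ∑ s, P s * Real.exp (c * Z s) ≤ Real.exp (c ^ 2 * v ^ 2 / (2 * (1 - c * b / 3))) := by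
  obtain ⟨k, hvar, hb⟩ := h.exists_shift
  have hd : 0 < 2 * (1 - c * b / 3) := by linarith
  set d := 2 * (1 - c * b / 3)
  have hexp : ∀ s, Real.exp (c * (Z s + k)) ≤ 1 + c * (Z s + k) + c ^ 2 / d * (Z s + k) ^ 2 :=
    fun s => (exp_le_one_add_add_sq_div (mul_le_mul_of_nonneg_left (hb s) hc) hcb).trans_eq
      (by ring)
  have hshifted : ∑ s, P s * Real.exp (c * (Z s + k)) ≤ 1 + c * k + c ^ 2 * v ^ 2 / d :=
    calc ∑ s, P s * Real.exp (c * (Z s + k))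
        ≤ ∑ s, P s * (1 + c * (Z s + k) + c ^ 2 / d * (Z s + k) ^ 2) := by
          gcongr with s
          · exact h.nonneg s
          · exact hexp s
      _ = (1 + c * k) * ∑ s, P s + c * ∑ s, P s * Z s
            + c ^ 2 / d * ∑ s, P s * (Z s + k) ^ 2 := by
          simp only [Finset.mul_sum, ← Finset.sum_add_distrib]
          exact Finset.sum_congr rfl fun s _ => by ring
      _ ≤ (1 + c * k) * 1 + c * 0 + c ^ 2 / d * v ^ 2 := by
          rw [h.sum_eq_one]
          gcongr
          exact h.mean_nonpos
      _ = 1 + c * k + c ^ 2 * v ^ 2 / d := by ring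
  calc ∑ s, P s * Real.exp (c * Z s)
      = Real.exp (-(c * k)) * ∑ s, P s * Real.exp (c * (Z s + k)) := by
        rw [Finset.mul_sum]
        refine Finset.sum_congr rfl fun s _ => ?_
        rw [mul_left_comm, ← Real.exp_add]
        ring_nf
    _ ≤ Real.exp (-(c * k)) * Real.exp (c * k + c ^ 2 * v ^ 2 / d) := by
        gcongr
        exact hshifted.trans (by linarith [Real.add_one_le_exp (c * k + c ^ 2 * v ^ 2 / d)])
    _ = Real.exp (c ^ 2 * v ^ 2 / d) := by rw [← Real.exp_add, neg_add_cancel_left]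

lemma BernsteinCondition.sum_mul_exp_sub_le (h : BernsteinCondition P Z v b) (hv : 0 < v)
    (hb : 0 ≤ b) (hr : 0 ≤ r) :
    ∑ s, P s * Real.exp (r / (v + b * r / 3) * (Z s - (v * r + b / 3 * (r ^ 2 / 2))))
      ≤ Real.exp (-(r ^ 2 / 2)) := by
  have hd : 0 < v + b * r / 3 := by positivity
  set c := r / (v + b * r / 3) with hc_def
  set t := v * r + b / 3 * (r ^ 2 / 2)
  have hcb : c * b < 3 := by
    rw [hc_def, div_mul_eq_mul_div, div_lt_iff₀ hd]
    linarith
  have hexponent : c ^ 2 * v ^ 2 / (2 * (1 - c * b / 3)) - c * t = -(r ^ 2 / 2) := by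
    have hcb' : 1 - c * b / 3 = v / (v + b * r / 3) := by
      rw [hc_def]
      field_simp
      ring
    rw [hcb', hc_def]
    simp only [t]
    field_simp
    ring
  calc ∑ s, P s * Real.exp (c * (Z s - t))
      = Real.exp (-(c * t)) * ∑ s, P s * Real.exp (c * Z s) := by
        rw [Finset.mul_sum]
        refine Finset.sum_congr rfl fun s _ => ?_
        rw [mul_left_comm, ← Real.exp_add]
        ring_nf
    _ ≤ Real.exp (-(c * t)) * Real.exp (c ^ 2 * v ^ 2 / (2 * (1 - c * b / 3))) := by
        gcongr
        exact h.sum_mul_exp_le (by positivity) hcb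
    _ = Real.exp (-(r ^ 2 / 2)) := by
        rw [← Real.exp_add, ← hexponent]
        ring_nf

end Bernstein

section ConditionalLaw

variable {Ω S S' T T' : Type*} [MeasurableSpace Ω] [MeasurableSpace T] [MeasurableSpace T']
  [Fintype S] [Fintype S'] {μ : Measure Ω} {Y : Ω → S} {Z : Ω → T} {q : S → T → ℝ≥0∞}

/-- The finitely-valued `Y` has conditional law `q · z` given `Z = z`, expressed by integration
against test functions. The weights need not be the values of a probability kernel outside the
support of `Z`. -/
structure IsCondLaw (μ : Measure Ω) (Y : Ω → S) (Z : Ω → T) (q : S → T → ℝ≥0∞) : Prop where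
  measurable_weight : ∀ y, Measurable (q y)
  lintegral_eq : ∀ g : S → T → ℝ≥0∞, (∀ y, Measurable (g y)) →
    ∫⁻ ω, g (Y ω) (Z ω) ∂μ = ∫⁻ ω, ∑ y, q y (Z ω) * g y (Z ω) ∂μ

lemma isCondLaw_condDistrib [MeasurableSpace S] [StandardBorelSpace S] [Nonempty S]
    [IsFiniteMeasure μ] (hY : Measurable Y) (hZ : Measurable Z) :
    IsCondLaw μ Y Z fun y z => condDistrib Y Z μ z {y} := by
  have hq : ∀ y, Measurable fun z => condDistrib Y Z μ z {y} := fun y =>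
    (condDistrib Y Z μ).measurable_coe (measurableSet_singleton y)
  refine ⟨hq, fun g hg => ?_⟩
  have hg' : Measurable fun s : T × S => g s.2 s.1 := measurable_from_prod_countable_left hg
  calc ∫⁻ ω, g (Y ω) (Z ω) ∂μ
      = ∫⁻ s, g s.2 s.1 ∂(μ.map fun ω => (Z ω, Y ω)) :=
        (lintegral_map hg' (hZ.prodMk hY)).symm
    _ = ∫⁻ z, ∫⁻ y, g y z ∂(condDistrib Y Z μ z) ∂(μ.map Z) := by
        rw [← compProd_map_condDistrib hY.aemeasurable, Measure.lintegral_compProd hg']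
    _ = ∫⁻ z, ∑ y, condDistrib Y Z μ z {y} * g y z ∂(μ.map Z) := by
        simp only [lintegral_fintype, mul_comm]
    _ = ∫⁻ ω, ∑ y, condDistrib Y Z μ (Z ω) {y} * g y (Z ω) ∂μ :=
        lintegral_map (Finset.measurable_sum _ fun y _ => (hq y).mul (hg y)) hZ

lemma isCondLaw_of_condProb_ae_eq [MeasurableSpace S] [StandardBorelSpace S] [Nonempty S]
    [IsFiniteMeasure μ] (hY : Measurable Y) (hZ : Measurable Z)
    {r : S → T → ℝ} (hr : ∀ y, Measurable (r y))
    (h : ∀ y, ∀ᵐ ω ∂μ, condProb μ Y Z y ω = r y (Z ω)) :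
    IsCondLaw μ Y Z fun y z => ENNReal.ofReal (r y z) := by
  refine ⟨fun y => (hr y).ennreal_ofReal, fun g hg => ?_⟩
  rw [(isCondLaw_condDistrib hY hZ).lintegral_eq g hg]
  refine lintegral_congr_ae ?_
  filter_upwards [ae_all_iff.2 h] with ω hω
  simp only [← hω, condProb, ofReal_measureReal (measure_ne_top _ _)]

namespace IsCondLaw

lemma ae_eq [IsFiniteMeasure μ] {q' : S → T → ℝ≥0∞} (hZ : Measurable Z) (h : IsCondLaw μ Y Z q)
    (h' : IsCondLaw μ Y Z q') : ∀ᵐ ω ∂μ, ∀ y, q y (Z ω) = q' y (Z ω) := by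
  classical
  refine ae_all_iff.2 fun y => ?_
  have hset : ∀ {r : S → T → ℝ≥0∞}, IsCondLaw μ Y Z r → ∀ s, MeasurableSet s →
      ∫⁻ z in s, r y z ∂(μ.map Z) = ∫⁻ ω, if Y ω = y then s.indicator 1 (Z ω) else 0 ∂μ := by
    intro r hr s hs
    rw [hr.lintegral_eq (fun y' z => if y' = y then s.indicator 1 z else 0),
      ← lintegral_indicator hs, lintegral_map ((hr.measurable_weight y).indicator hs) hZ]
    · refine lintegral_congr fun ω => ?_
      by_cases hω : Z ω ∈ s <;> simp [hω]
    · intro y'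
      by_cases hy : y' = y
      · simpa only [hy, if_true] using measurable_one.indicator hs
      · simpa only [hy, if_false] using measurable_const
  have heq : q y =ᵐ[μ.map Z] q' y :=
    ae_eq_of_forall_setLIntegral_eq_of_sigmaFinite (h.measurable_weight y)
      (h'.measurable_weight y) fun s hs _ => (hset h s hs).trans (hset h' s hs).symm
  exact ae_of_ae_map hZ.aemeasurable heq

lemma condProb_ae_eq [MeasurableSpace S] [StandardBorelSpace S] [Nonempty S]
    [IsFiniteMeasure μ] (hY : Measurable Y) (hZ : Measurable Z)
    (h : IsCondLaw μ Y Z q) : ∀ᵐ ω ∂μ, ∀ y, condProb μ Y Z y ω = (q y (Z ω)).toReal := by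
  filter_upwards [(isCondLaw_condDistrib hY hZ).ae_eq hZ h] with ω hω y
  rw [condProb, measureReal_def, hω]

lemma ae_iff [MeasurableSpace S] [MeasurableSingletonClass S] (hY : Measurable Y)
    (hZ : Measurable Z) (h : IsCondLaw μ Y Z q) {φ : S → T → Prop}
    (hφ : ∀ y, MeasurableSet {z | φ y z}) :
    (∀ᵐ ω ∂μ, φ (Y ω) (Z ω)) ↔ ∀ᵐ ω ∂μ, ∀ y, q y (Z ω) ≠ 0 → φ y (Z ω) := by
  classical
  let g : S → T → ℝ≥0∞ := fun y => {z | φ y z}ᶜ.indicator 1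
  have hg : ∀ y, Measurable (g y) := fun y => measurable_one.indicator (hφ y).compl
  have hg' : Measurable fun s : S × T => g s.1 s.2 := measurable_from_prod_countable_right hg
  have hg0 : ∀ y z, g y z = 0 ↔ φ y z := by simp [g]
  have hsum : Measurable fun ω => ∑ y, q y (Z ω) * g y (Z ω) := Finset.measurable_sum _ fun y _ =>
    ((h.measurable_weight y).comp hZ).mul ((hg y).comp hZ)
  have hint := h.lintegral_eq g hg
  calc (∀ᵐ ω ∂μ, φ (Y ω) (Z ω)) ↔ ∫⁻ ω, g (Y ω) (Z ω) ∂μ = 0 := by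
        rw [lintegral_eq_zero_iff (f := fun ω => g (Y ω) (Z ω)) (hg'.comp (hY.prodMk hZ))]
        simp only [Filter.EventuallyEq, Pi.zero_apply, hg0]
    _ ↔ ∀ᵐ ω ∂μ, ∀ y, q y (Z ω) ≠ 0 → φ y (Z ω) := by
        rw [hint, lintegral_eq_zero_iff hsum]
        simp only [Filter.EventuallyEq, Pi.zero_apply, Finset.sum_eq_zero_iff, Finset.mem_univ,
          true_imp_iff, mul_eq_zero, hg0, or_iff_not_imp_left, ne_eq]

lemma comp_of_leftInverse {f : T → T'} {g : T' → T} (h : IsCondLaw μ Y Z q) (hf : Measurable f)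
    (hg : Measurable g) (hgf : Function.LeftInverse g f) :
    IsCondLaw μ Y (fun ω => f (Z ω)) fun y z => q y (g z) := by
  refine ⟨fun y => (h.measurable_weight y).comp hg, fun φ hφ => ?_⟩
  simp only [hgf _]
  exact h.lintegral_eq (fun y z => φ y (f z)) fun y => (hφ y).comp hf

lemma equiv_comp (h : IsCondLaw μ Y Z q) (e : S ≃ S') :
    IsCondLaw μ (fun ω => e (Y ω)) Z fun y => q (e.symm y) := by
  refine ⟨fun y => h.measurable_weight _, fun g hg => ?_⟩
  rw [h.lintegral_eq (fun y => g (e y)) fun y => hg _]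
  refine lintegral_congr fun ω => ?_
  rw [← e.sum_comp]
  simp only [e.symm_apply_apply]

lemma prodMk [MeasurableSpace S] [DiscreteMeasurableSpace S] {Y' : Ω → S'}
    {q' : S' → S × T → ℝ≥0∞} (h : IsCondLaw μ Y Z q)
    (h' : IsCondLaw μ Y' (fun ω => (Y ω, Z ω)) q') :
    IsCondLaw μ (fun ω => (Y' ω, Y ω)) Z fun s z => q' s.1 (s.2, z) * q s.2 z := by
  have hq' : ∀ y y', Measurable fun z => q' y' (y, z) := fun y y' =>
    (h'.measurable_weight y').comp measurable_prodMk_left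
  refine ⟨fun s => (hq' _ _).mul (h.measurable_weight _), fun g hg => ?_⟩
  calc ∫⁻ ω, g (Y' ω, Y ω) (Z ω) ∂μ
      = ∫⁻ ω, ∑ y', q' y' (Y ω, Z ω) * g (y', Y ω) (Z ω) ∂μ :=
        h'.lintegral_eq (fun y' s => g (y', s.1) s.2) fun y' =>
          measurable_from_prod_countable_right fun y => hg (y', y)
    _ = ∫⁻ ω, ∑ y, q y (Z ω) * ∑ y', q' y' (y, Z ω) * g (y', y) (Z ω) ∂μ :=
        h.lintegral_eq (fun y z => ∑ y', q' y' (y, z) * g (y', y) z) fun y =>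
          Finset.measurable_sum _ fun y' _ => (hq' y y').mul (hg (y', y))
    _ = ∫⁻ ω, ∑ s : S' × S, q' s.1 (s.2, Z ω) * q s.2 (Z ω) * g s (Z ω) ∂μ := by
        refine lintegral_congr fun ω => ?_
        rw [Fintype.sum_prod_type_right]
        simp only [Finset.mul_sum]
        exact Finset.sum_congr rfl fun y _ => Finset.sum_congr rfl fun y' _ => by ring

lemma condIndep_symm [MeasurableSpace S] [DiscreteMeasurableSpace S] [MeasurableSpace S']
    {X : Ω → S'} {r : S' → T → ℝ≥0∞} (h : IsCondLaw μ Y Z q)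
    (hX : IsCondLaw μ X (fun ω => (Y ω, Z ω)) fun x s => r x s.2)
    (hr : ∀ x, Measurable (r x)) :
    IsCondLaw μ Y (fun ω => (X ω, Z ω)) fun y s => q y s.2 := by
  refine ⟨fun y => (h.measurable_weight y).comp measurable_snd, fun g hg => ?_⟩
  have hg' : ∀ x y, Measurable fun z => g y (x, z) := fun x y => (hg y).comp measurable_prodMk_left
  let G : S' → T → ℝ≥0∞ := fun x z => ∑ y, q y z * g y (x, z)
  have hG : ∀ x, Measurable (G x) := fun x => Finset.measurable_sum _ fun y _ =>
    (h.measurable_weight y).mul (hg' x y)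
  calc ∫⁻ ω, g (Y ω) (X ω, Z ω) ∂μ
      = ∫⁻ ω, ∑ x, r x (Z ω) * g (Y ω) (x, Z ω) ∂μ :=
        hX.lintegral_eq (fun x s => g s.1 (x, s.2)) fun x =>
          measurable_from_prod_countable_right fun y => hg' x y
    _ = ∫⁻ ω, ∑ y, q y (Z ω) * ∑ x, r x (Z ω) * g y (x, Z ω) ∂μ :=
        h.lintegral_eq (fun y z => ∑ x, r x z * g y (x, z)) fun y =>
          Finset.measurable_sum _ fun x _ => (hr x).mul (hg' x y)
    _ = ∫⁻ ω, ∑ x, r x (Z ω) * G x (Z ω) ∂μ := by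
        refine lintegral_congr fun ω => ?_
        simp only [G, Finset.mul_sum]
        rw [Finset.sum_comm]
        exact Finset.sum_congr rfl fun x _ => Finset.sum_congr rfl fun y _ => by ring
    _ = ∫⁻ ω, G (X ω) (Z ω) ∂μ :=
        (hX.lintegral_eq (fun x s => G x s.2) fun x => (hG x).comp measurable_snd).symm

end IsCondLaw

end ConditionalLaw

section Rounds

variable {Ω L S : Type*} [MeasurableSpace Ω] [MeasurableSpace L] {μ : Measure Ω} {n : ℕ}

/-- The values of the process `Y` before round `i`, together with the side information `Λ`. -/
def history (Y : Fin n → Ω → S) (Λ : Ω → L) (i : Fin n) (ω : Ω) : (Fin i → S) × L :=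
  (fun j => Y (Fin.castLE i.isLt.le j) ω, Λ ω)

lemma measurable_history [MeasurableSpace S] {Y : Fin n → Ω → S} {Λ : Ω → L}
    (hY : ∀ i, Measurable (Y i)) (hΛ : Measurable Λ) (i : Fin n) : Measurable (history Y Λ i) :=
  (measurable_pi_lambda _ fun _ => hY _).prodMk hΛ

variable [Fintype S] [MeasurableSpace S] [DiscreteMeasurableSpace S]

lemma lintegral_prod_le_pow {Y : Fin n → Ω → S} {Λ : Ω → L} {δ : ℝ≥0∞}
    {q g : (i : Fin n) → S → (Fin i → S) × L → ℝ≥0∞}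
    (hδ : δ ≠ ∞) (hq : ∀ i, IsCondLaw μ (Y i) (history Y Λ i) (q i))
    (hg : ∀ i y, Measurable (g i y))
    (hle : ∀ i, ∀ᵐ ω ∂μ, ∑ y, q i y (history Y Λ i ω) * g i y (history Y Λ i ω) ≤ δ) :
    ∫⁻ ω, ∏ i, g i (Y i ω) (history Y Λ i ω) ∂μ ≤ δ ^ n * μ Set.univ := by
  induction n with
  | zero => simp
  | succ n ih =>
    let W : Ω → (Fin n → S) × L := history Y Λ (Fin.last n)
    let G : (Fin n → S) × L → ℝ≥0∞ := fun w =>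
      ∏ i : Fin n, g i.castSucc (w.1 i) (fun j => w.1 (Fin.castLE i.isLt.le j), w.2)
    have hG : Measurable G := Finset.measurable_prod _ fun i _ =>
      (measurable_from_prod_countable_right (f := fun s : S × _ => g i.castSucc s.1 s.2)
        (hg i.castSucc)).comp (f := fun w : (Fin n → S) × L => (w.1 i, _, w.2)) (by fun_prop)
    calc ∫⁻ ω, ∏ i, g i (Y i ω) (history Y Λ i ω) ∂μ
        = ∫⁻ ω, G (W ω) * g (Fin.last n) (Y (Fin.last n) ω) (W ω) ∂μ := by
          simp only [Fin.prod_univ_castSucc]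
          rfl
      _ = ∫⁻ ω, ∑ y, q (Fin.last n) y (W ω) * (G (W ω) * g (Fin.last n) y (W ω)) ∂μ :=
          (hq (Fin.last n)).lintegral_eq (fun y w => G w * g (Fin.last n) y w) fun y =>
            hG.mul (hg _ y)
      _ ≤ ∫⁻ ω, δ * G (W ω) ∂μ := by
          refine lintegral_mono_ae ?_
          filter_upwards [hle (Fin.last n)] with ω hω
          simp only [mul_left_comm _ (G _), ← Finset.mul_sum]
          rw [mul_comm δ]
          gcongr
      _ = δ * ∫⁻ ω, G (W ω) ∂μ := lintegral_const_mul' δ _ hδ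
      _ ≤ δ * (δ ^ n * μ Set.univ) := by
          gcongr
          exact ih (Y := fun i => Y i.castSucc) (q := fun i => q i.castSucc)
            (g := fun i => g i.castSucc) (fun i => hq i.castSucc) (fun i => hg i.castSucc)
            fun i => hle i.castSucc
      _ = δ ^ (n + 1) * μ Set.univ := by rw [pow_succ', mul_assoc]

lemma measureReal_mul_lt_sum_le_exp [IsProbabilityMeasure μ] {Y : Fin n → Ω → S} {Λ : Ω → L}
    {P f : (i : Fin n) → S → (Fin i → S) × L → ℝ} {c t κ : ℝ}
    (hY : ∀ i, Measurable (Y i)) (hΛ : Measurable Λ) (hf : ∀ i y, Measurable (f i y))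
    (hP : ∀ i, IsCondLaw μ (Y i) (history Y Λ i) fun y w => ENNReal.ofReal (P i y w))
    (hP0 : ∀ i, ∀ᵐ ω ∂μ, ∀ y, 0 ≤ P i y (history Y Λ i ω)) (hc : 0 ≤ c)
    (hle : ∀ i, ∀ᵐ ω ∂μ, ∑ y, P i y (history Y Λ i ω)
      * Real.exp (c * (f i y (history Y Λ i ω) - t)) ≤ Real.exp (-κ)) :
    μ.real {ω | n * t < ∑ i, f i (Y i ω) (history Y Λ i ω)} ≤ Real.exp (-(n * κ)) := by
  let g : (i : Fin n) → S → (Fin i → S) × L → ℝ≥0∞ := fun i y w =>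
    ENNReal.ofReal (Real.exp (c * (f i y w - t)))
  have hg : ∀ i y, Measurable (g i y) := fun i y =>
    (((hf i y).sub_const t).const_mul c).exp.ennreal_ofReal
  have hstep : ∀ i, ∀ᵐ ω ∂μ, ∑ y, ENNReal.ofReal (P i y (history Y Λ i ω))
      * g i y (history Y Λ i ω) ≤ ENNReal.ofReal (Real.exp (-κ)) := fun i => by
    filter_upwards [hP0 i, hle i] with ω h0 hω
    simp only [g, ← ENNReal.ofReal_mul (h0 _)]
    rw [← ENNReal.ofReal_sum_of_nonneg fun y _ => mul_nonneg (h0 y) (Real.exp_nonneg _)]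
    exact ENNReal.ofReal_le_ofReal hω
  have hprod : ∀ ω, ∏ i, g i (Y i ω) (history Y Λ i ω)
      = ENNReal.ofReal (Real.exp (c * (∑ i, f i (Y i ω) (history Y Λ i ω) - n * t))) := fun ω => by
    simp only [g]
    rw [← ENNReal.ofReal_prod_of_nonneg fun i _ => Real.exp_nonneg _, ← Real.exp_sum]
    simp only [← Finset.mul_sum, Finset.sum_sub_distrib, Finset.sum_const, Finset.card_univ,
      Fintype.card_fin, nsmul_eq_mul]
  have hmeas : Measurable fun ω => ∏ i, g i (Y i ω) (history Y Λ i ω) :=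
    Finset.measurable_prod _ fun i _ =>
      (measurable_from_prod_countable_right (f := fun s : S × _ => g i s.1 s.2) (hg i)).comp
        ((hY i).prodMk (measurable_history hY hΛ i))
  refine ENNReal.toReal_le_of_le_ofReal (Real.exp_nonneg _) ?_
  calc μ {ω | n * t < ∑ i, f i (Y i ω) (history Y Λ i ω)}
      ≤ ∫⁻ ω, ∏ i, g i (Y i ω) (history Y Λ i ω) ∂μ := by
        refine meas_le_lintegral₀ hmeas.aemeasurable fun ω hω => ?_
        rw [hprod, ENNReal.one_le_ofReal, Real.one_le_exp_iff]
        exact mul_nonneg hc (sub_nonneg.2 (le_of_lt hω))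
    _ ≤ ENNReal.ofReal (Real.exp (-κ)) ^ n * μ Set.univ :=
        lintegral_prod_le_pow ENNReal.ofReal_ne_top hP hg hstep
    _ = ENNReal.ofReal (Real.exp (-(n * κ))) := by
        rw [measure_univ, mul_one, ← ENNReal.ofReal_pow (Real.exp_nonneg _), ← Real.exp_nat_mul,
          mul_neg]

lemma measureReal_mul_lt_sum_le_of_bernsteinCondition [IsProbabilityMeasure μ]
    {Y : Fin n → Ω → S} {Λ : Ω → L} {P f : (i : Fin n) → S → (Fin i → S) × L → ℝ} {v b r : ℝ}
    (hY : ∀ i, Measurable (Y i)) (hΛ : Measurable Λ) (hf : ∀ i y, Measurable (f i y))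
    (hP : ∀ i, IsCondLaw μ (Y i) (history Y Λ i) fun y w => ENNReal.ofReal (P i y w))
    (hbern : ∀ i, ∀ᵐ ω ∂μ,
      BernsteinCondition (P i · (history Y Λ i ω)) (f i · (history Y Λ i ω)) v b)
    (hv : 0 < v) (hb : 0 ≤ b) (hr : 0 ≤ r) :
    μ.real {ω | n * (v * r + b / 3 * (r ^ 2 / 2)) < ∑ i, f i (Y i ω) (history Y Λ i ω)}
      ≤ Real.exp (-(n * (r ^ 2 / 2))) :=
  measureReal_mul_lt_sum_le_exp hY hΛ hf hP (fun i => (hbern i).mono fun _ h => h.nonneg)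
    (by positivity : 0 ≤ r / (v + b * r / 3))
    fun i => (hbern i).mono fun _ h => h.sum_mul_exp_sub_le hv hb hr

end Rounds

section InputOutput

variable {Ω L B C : Type*} [MeasurableSpace Ω] [MeasurableSpace L] {μ : Measure Ω}
  [Fintype B] [MeasurableSpace B] [DiscreteMeasurableSpace B]
  [Fintype C] [MeasurableSpace C] [DiscreteMeasurableSpace C]

lemma isCondLaw_snoc {n : ℕ} {A : Fin (n + 1) → Ω → B} {X : Fin (n + 1) → Ω → C} {Λ : Ω → L}
    {p : C → ℝ≥0∞} {q : B → C × (Fin n → B × C) × L → ℝ≥0∞}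
    {Q : (Fin n → B) → (Fin n → C) × L → ℝ≥0∞}
    (hX : IsCondLaw μ (X (Fin.last n))
      (history (fun i ω => (A i ω, X i ω)) Λ (Fin.last n)) fun x _ => p x)
    (hA : IsCondLaw μ (A (Fin.last n))
      (fun ω => (X (Fin.last n) ω, history (fun i ω => (A i ω, X i ω)) Λ (Fin.last n) ω)) q)
    (h : IsCondLaw μ (fun ω (i : Fin n) => A i.castSucc ω)
      (fun ω => (fun i : Fin n => X i.castSucc ω, Λ ω)) Q) :
    IsCondLaw μ (fun ω i => A i ω) (fun ω => (fun i => X i ω, Λ ω)) fun a z =>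
      q (a (Fin.last n)) (z.1 (Fin.last n), fun j => (a j.castSucc, z.1 j.castSucc), z.2)
        * Q (fun j => a j.castSucc) (fun j => z.1 j.castSucc, z.2) := by
  let A' : Ω → Fin n → B := fun ω i => A i.castSucc ω
  let X' : Ω → Fin n → C := fun ω i => X i.castSucc ω
  have hXlast : IsCondLaw μ (X (Fin.last n)) (fun ω => (A' ω, X' ω, Λ ω)) fun x _ => p x :=
    hX.comp_of_leftInverse
      (f := fun w : (Fin n → B × C) × L => (fun j => (w.1 j).1, fun j => (w.1 j).2, w.2))
      (g := fun z => (fun j => (z.1 j, z.2.1 j), z.2.2))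
      (by fun_prop) (by fun_prop) fun _ => rfl
  have hAlast : IsCondLaw μ (A (Fin.last n)) (fun ω => (A' ω, X (Fin.last n) ω, X' ω, Λ ω))
      fun a z => q a (z.2.1, fun j => (z.1 j, z.2.2.1 j), z.2.2.2) :=
    hA.comp_of_leftInverse
      (f := fun w : C × (Fin n → B × C) × L =>
        (fun j => (w.2.1 j).1, w.1, fun j => (w.2.1 j).2, w.2.2))
      (g := fun z => (z.2.1, fun j => (z.1 j, z.2.2.1 j), z.2.2.2))
      (by fun_prop) (by fun_prop) fun _ => rfl
  have hsnoc : Measurable fun s : C × (Fin n → C) => (Fin.snoc s.2 s.1 : Fin (n + 1) → C) :=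
    .of_discrete
  have hall := (((h.condIndep_symm hXlast fun _ => measurable_const).prodMk hAlast).equiv_comp
    (Fin.snocEquiv fun _ => B)).comp_of_leftInverse
      (f := fun z => ((Fin.snoc z.2.1 z.1 : Fin (n + 1) → C), z.2.2))
      (g := fun z => (z.1 (Fin.last n), fun j => z.1 j.castSucc, z.2))
      ((hsnoc.comp (measurable_fst.prodMk measurable_snd.fst)).prodMk measurable_snd.snd)
      (by fun_prop) fun z => by simp
  convert hall using 1
  · exact funext fun ω => (Fin.snoc_init_self fun i => A i ω).symm
  · exact funext fun ω => congrArg (·, Λ ω) (Fin.snoc_init_self fun i => X i ω).symm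
  · rfl

/-- Conditioning on all inputs at once is harmless: each of them is drawn regardless of the past, so
later inputs carry no information about earlier outputs. -/
lemma isCondLaw_pi {n : ℕ} {A : Fin n → Ω → B} {X : Fin n → Ω → C} {Λ : Ω → L} {p : C → ℝ≥0∞}
    {q : (i : Fin n) → B → C × (Fin i → B × C) × L → ℝ≥0∞}
    (hX : ∀ i, IsCondLaw μ (X i) (history (fun i ω => (A i ω, X i ω)) Λ i) fun x _ => p x)
    (hA : ∀ i, IsCondLaw μ (A i) (fun ω => (X i ω, history (fun i ω => (A i ω, X i ω)) Λ i ω))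
      (q i)) :
    IsCondLaw μ (fun ω i => A i ω) (fun ω => (fun i => X i ω, Λ ω)) fun a z =>
      ∏ i : Fin n, q i (a i) (z.1 i,
        (fun j => (a (Fin.castLE i.isLt.le j), z.1 (Fin.castLE i.isLt.le j)), z.2)) := by
  induction n with
  | zero =>
    refine ⟨fun _ => by simp, fun g _ => lintegral_congr fun ω => ?_⟩
    simp [Subsingleton.elim (fun i => A i ω) default]
  | succ n ih =>
    have hinit := ih (A := fun i => A i.castSucc) (X := fun i => X i.castSucc)
      (q := fun i => q i.castSucc) (fun i => hX i.castSucc) fun i => hA i.castSucc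
    simp only [Fin.prod_univ_castSucc, mul_comm (∏ _, _)]
    exact isCondLaw_snoc (hX (Fin.last n)) (hA (Fin.last n)) hinit

end InputOutput

section Energy

lemma IsRealizable.energy_nonneg {q : Behaviour} (hq : IsRealizable q) : 0 ≤ q.2 := by
  obtain ⟨H, _, _, _, ρ, M, O, hρ, -, -, -, -, hO⟩ := hq
  intro x
  obtain ⟨s, hs, hsw⟩ := hO x
  refine le_trans (hs.nonneg fun i => mul_nonneg ?_ ?_) hsw
  · by_cases hi : i = O.vac
    · rw [hi, O.eig_vac]
    · linarith [O.one_le_eig _ hi]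
  · exact (Complex.nonneg_iff.1 ((hρ x).1.inner_nonneg_right (O.basis i))).1

lemma energy_nonneg_of_mem_quantumSet {q : Behaviour} (hq : q ∈ quantumSet) : 0 ≤ q.2 := by
  refine convexHull_min (t := {q : Behaviour | 0 ≤ q.2}) (fun q h => h.energy_nonneg) ?_ hq
  exact (convex_Ici (0 : Fin 2 → ℝ)).linear_preimage (LinearMap.snd ℝ _ _)

end Energy

section SingleRound

variable {p α β γ E e : Fin 2 → ℝ}

lemma xi_mem_Icc (p α β : Fin 2 → ℝ) (a : Bool) (x : Fin 2) :
    xi p α β a x ∈ Set.Icc (xiMin p α β) (xiMax p α β) :=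
  ⟨ciInf_le (f := fun q : Bool × Fin 2 => xi p α β q.1 q.2) (Set.finite_range _).bddBelow (a, x),
    le_ciSup (f := fun q : Bool × Fin 2 => xi p α β q.1 q.2) (Set.finite_range _).bddAbove (a, x)⟩

lemma sum_outProb (E : Fin 2 → ℝ) (x : Fin 2) : ∑ a, outProb E a x = 1 := by
  simp only [Fintype.sum_bool, outProb, sgn, if_true, Bool.false_eq_true, if_false]
  ring

lemma outProb_le_one (hE : ∀ a x, 0 ≤ outProb E a x) (a : Bool) (x : Fin 2) :
    outProb E a x ≤ 1 :=
  (Finset.single_le_sum (fun a _ => hE a x) (Finset.mem_univ a)).trans_eq (sum_outProb E x)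

lemma logb_outProb_nonpos (hE : ∀ a x, 0 ≤ outProb E a x) (a : Bool) (x : Fin 2) :
    Real.logb 2 (outProb E a x) ≤ 0 :=
  Real.logb_nonpos one_lt_two (hE a x) (outProb_le_one hE a x)

lemma sum_outProb_mul_neg_logb_le_one (E : Fin 2 → ℝ) (x : Fin 2) :
    ∑ a, outProb E a x * -Real.logb 2 (outProb E a x) ≤ 1 := by
  have hfalse : outProb E false x = 1 - outProb E true x := by
    have := sum_outProb E x
    rw [Fintype.sum_bool] at this
    linarith
  have hlog : 0 < Real.log 2 := Real.log_pos one_lt_two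
  calc ∑ a, outProb E a x * -Real.logb 2 (outProb E a x)
      = Real.binEntropy (outProb E true x) / Real.log 2 := by
        rw [Fintype.sum_bool, hfalse, Real.binEntropy, Real.log_inv, Real.log_inv, Real.logb,
          Real.logb]
        ring
    _ ≤ 1 := (div_le_one hlog).2 Real.binEntropy_le_log_two

lemma sum_outProb_mul_logb_sq_le (hE : ∀ a x, 0 ≤ outProb E a x) (x : Fin 2) :
    ∑ a, outProb E a x * Real.logb 2 (outProb E a x) ^ 2
      ≤ 4 * (Fintype.card Bool : ℝ) / Real.exp 1 ^ 2 * Real.logb 2 (Real.exp 1) ^ 2 :=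
  calc ∑ a, outProb E a x * Real.logb 2 (outProb E a x) ^ 2
      ≤ ∑ _a : Bool, 4 / Real.exp 1 ^ 2 * Real.logb 2 (Real.exp 1) ^ 2 :=
        Finset.sum_le_sum fun a _ => mul_logb_sq_le 2 (hE a x) (outProb_le_one hE a x)
    _ = _ := by
        rw [Finset.sum_const, Finset.card_univ, nsmul_eq_mul]
        ring

/-- The joint law of the output and the input of a round in which the correlations are `E`. -/
noncomputable def roundLaw (p E : Fin 2 → ℝ) (s : Bool × Fin 2) : ℝ := p s.2 * outProb E s.1 s.2

/-- The amount by which a round with output `a` and input `x` violates the trade-off inequality,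
the entropy being replaced by the surprisal `-log p(a|x)` of the output. -/
noncomputable def roundScore (p α β γ E e : Fin 2 → ℝ) (a : Bool) (x : Fin 2) : ℝ :=
  xi p α β a x + ∑ y, γ y * e y + Real.logb 2 (outProb E a x)

lemma sum_roundLaw_mul (f : Bool × Fin 2 → ℝ) :
    ∑ s, roundLaw p E s * f s = ∑ x, p x * ∑ a, outProb E a x * f (a, x) := by
  simp only [Fintype.sum_prod_type_right, Finset.mul_sum, roundLaw, mul_assoc]

lemma roundLaw_nonneg (hp : ∀ x, 0 ≤ p x) (hE : ∀ a x, 0 ≤ outProb E a x) (s : Bool × Fin 2) :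
    0 ≤ roundLaw p E s :=
  mul_nonneg (hp _) (hE _ _)

lemma sum_roundLaw (hp1 : ∑ x, p x = 1) : ∑ s, roundLaw p E s = 1 := by
  simpa only [mul_one, sum_outProb, hp1] using sum_roundLaw_mul (p := p) (E := E) fun _ => 1

lemma sum_roundLaw_mul_le (hp : ∀ x, 0 ≤ p x) (hp1 : ∑ x, p x = 1) {f : Bool × Fin 2 → ℝ} {c : ℝ}
    (hf : ∀ x, ∑ a, outProb E a x * f (a, x) ≤ c) : ∑ s, roundLaw p E s * f s ≤ c :=
  calc ∑ s, roundLaw p E s * f s = ∑ x, p x * ∑ a, outProb E a x * f (a, x) := sum_roundLaw_mul f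
    _ ≤ ∑ x, p x * c := Finset.sum_le_sum fun x _ => mul_le_mul_of_nonneg_left (hf x) (hp x)
    _ = c := by rw [← Finset.sum_mul, hp1, one_mul]

lemma sum_roundLaw_mul_xi (hp : ∀ x, p x ≠ 0) :
    ∑ s, roundLaw p E s * xi p α β s.1 s.2 = ∑ x, α x + ∑ x, β x * E x := by
  rw [sum_roundLaw_mul, ← Finset.sum_add_distrib]
  refine Finset.sum_congr rfl fun x _ => ?_
  have := hp x
  simp only [Fintype.sum_bool, outProb, xi, sgn, if_true, Bool.false_eq_true, if_false]
  field_simp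
  ring

lemma sum_roundLaw_mul_logb :
    ∑ s, roundLaw p E s * Real.logb 2 (outProb E s.1 s.2) = -entropy p E := by
  rw [entropy, neg_neg, Fintype.sum_prod_type]
  rfl

lemma sum_roundLaw_mul_roundScore (hp : ∀ x, p x ≠ 0) (hp1 : ∑ x, p x = 1) :
    ∑ s, roundLaw p E s * roundScore p α β γ E e s.1 s.2
      = ∑ x, α x + ∑ x, β x * E x + ∑ x, γ x * e x - entropy p E := by
  simp only [roundScore, mul_add, Finset.sum_add_distrib]
  rw [sum_roundLaw_mul_xi hp, sum_roundLaw_mul_logb, ← Finset.sum_mul, sum_roundLaw hp1]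
  ring

lemma roundScore_le_xiMax (hE : ∀ a x, 0 ≤ outProb E a x) (he : 0 ≤ e) (hγ : γ ≤ 0)
    (a : Bool) (x : Fin 2) : roundScore p α β γ E e a x ≤ xiMax p α β := by
  have henergy : ∑ y, γ y * e y ≤ 0 :=
    Finset.sum_nonpos fun y _ => mul_nonpos_of_nonpos_of_nonneg (hγ y) (he y)
  rw [roundScore]
  linarith [(xi_mem_Icc p α β a x).2, logb_outProb_nonpos hE a x]

lemma sum_roundLaw_mul_sq_le_varBound (hp : ∀ x, 0 ≤ p x) (hp1 : ∑ x, p x = 1)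
    (hE : ∀ a x, 0 ≤ outProb E a x) :
    ∑ s, roundLaw p E s * (xi p α β s.1 s.2 + ∑ y, γ y + Real.logb 2 (outProb E s.1 s.2)) ^ 2
      ≤ varBound p α β γ := by
  have hcard : Real.logb 2 (Fintype.card Bool) = 1 := by simp
  rw [varBound, hcard, one_mul, add_comm (∑ y, γ y) (xiMin p α β)]
  set g := ∑ y, γ y
  set m := max ((xiMax p α β + g) ^ 2) ((xiMin p α β + g) ^ 2)
  set K := max (-(xiMin p α β + g)) 0
  calc ∑ s, roundLaw p E s * (xi p α β s.1 s.2 + g + Real.logb 2 (outProb E s.1 s.2)) ^ 2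
      ≤ ∑ s, roundLaw p E s * (m + 2 * K * -Real.logb 2 (outProb E s.1 s.2)
          + Real.logb 2 (outProb E s.1 s.2) ^ 2) := by
        gcongr with s
        · exact roundLaw_nonneg hp hE s
        · obtain ⟨hmin, hmax⟩ := xi_mem_Icc p α β s.1 s.2
          exact add_sq_le_of_mem_Icc ⟨by gcongr, by gcongr⟩ (logb_outProb_nonpos hE _ _)
    _ = m * ∑ s, roundLaw p E s
          + 2 * K * ∑ s, roundLaw p E s * -Real.logb 2 (outProb E s.1 s.2)
          + ∑ s, roundLaw p E s * Real.logb 2 (outProb E s.1 s.2) ^ 2 := by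
        simp only [Finset.mul_sum, ← Finset.sum_add_distrib]
        exact Finset.sum_congr rfl fun s _ => by ring
    _ ≤ m * 1 + 2 * K * 1
          + 4 * (Fintype.card Bool : ℝ) / Real.exp 1 ^ 2 * Real.logb 2 (Real.exp 1) ^ 2 := by
        rw [sum_roundLaw hp1]
        gcongr
        · exact sum_roundLaw_mul_le hp hp1 (sum_outProb_mul_neg_logb_le_one E)
        · exact sum_roundLaw_mul_le hp hp1 (sum_outProb_mul_logb_sq_le hE)
    _ = _ := by ring

lemma varBound_pos (p α β γ : Fin 2 → ℝ) : 0 < varBound p α β γ := by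
  have he : 0 < Real.logb 2 (Real.exp 1) := Real.logb_pos one_lt_two (Real.one_lt_exp_iff.2 one_pos)
  unfold varBound
  positivity

lemma bernsteinCondition_roundLaw (hp : ∀ x, 0 < p x) (hp1 : ∑ x, p x = 1)
    (hE : ∀ a x, 0 ≤ outProb E a x) (hγ : γ ≤ 0)
    (htradeoff : ∑ x, α x + ∑ x, β x * E x + ∑ x, γ x * e x ≤ entropy p E) :
    BernsteinCondition (roundLaw p E) (fun s => roundScore p α β γ E e s.1 s.2)
      √(varBound p α β γ) (xiMax p α β) where
  nonneg := roundLaw_nonneg (fun x => (hp x).le) hE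
  sum_eq_one := sum_roundLaw hp1
  mean_nonpos := by
    rw [sum_roundLaw_mul_roundScore (fun x => (hp x).ne') hp1]
    exact sub_nonpos.2 htradeoff
  exists_shift := by
    have hshift : ∀ s : Bool × Fin 2,
        roundScore p α β γ E e s.1 s.2 + (∑ y, γ y - ∑ y, γ y * e y)
          = xi p α β s.1 s.2 + ∑ y, γ y + Real.logb 2 (outProb E s.1 s.2) := fun s => by
      rw [roundScore]
      ring
    refine ⟨∑ y, γ y - ∑ y, γ y * e y, ?_, fun s => ?_⟩
    · simp only [hshift, Real.sq_sqrt (varBound_pos p α β γ).le]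
      exact sum_roundLaw_mul_sq_le_varBound (fun x => (hp x).le) hp1 hE
    · rw [hshift]
      linarith [(xi_mem_Icc p α β s.1 s.2).2, logb_outProb_nonpos hE s.1 s.2,
        Finset.sum_nonpos fun y (_ : y ∈ Finset.univ) => hγ y]

end SingleRound

section NRounds

variable {Ω L : Type*} [MeasurableSpace Ω] [MeasurableSpace L] {μ : Measure Ω}
  [IsProbabilityMeasure μ] {n : ℕ} {A : Fin n → Ω → Bool} {X : Fin n → Ω → Fin 2} {Λ : Ω → L}
  {E en : (i : Fin n) → (Fin i.val → Bool × Fin 2) → L → Fin 2 → ℝ}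
  {p ωpk ωavg α β γ : Fin 2 → ℝ} {εω εt : ℝ}

/-- The sum of the scores of the `n` rounds. Almost surely it equals
`∑ i, (ξ(A_i, X_i) + γ · ω_i) + log μ(A^n | X^n, Λ)`. -/
noncomputable def totalScore (A : Fin n → Ω → Bool) (X : Fin n → Ω → Fin 2) (Λ : Ω → L)
    (E en : (i : Fin n) → (Fin i.val → Bool × Fin 2) → L → Fin 2 → ℝ) (p α β γ : Fin 2 → ℝ)
    (ω : Ω) : ℝ :=
  ∑ i, roundScore p α β γ (E i (past A X i ω) (Λ ω)) (en i (past A X i ω) (Λ ω)) (A i ω) (X i ω)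

namespace NRoundModel

lemma measurable_outProb (h : NRoundModel μ A X Λ E en p ωpk ωavg εω) (i : Fin n) (a : Bool)
    (x : Fin 2) :
    Measurable fun w : (Fin i → Bool × Fin 2) × L => outProb (E i w.1 w.2) a x := by
  have hE : Measurable fun w : (Fin i → Bool × Fin 2) × L => E i w.1 w.2 :=
    measurable_from_prod_countable_right (h.measurable_E i)
  unfold outProb
  fun_prop

lemma measurable_roundScore (h : NRoundModel μ A X Λ E en p ωpk ωavg εω) (i : Fin n) (a : Bool)
    (x : Fin 2) :
    Measurable fun w : (Fin i → Bool × Fin 2) × L =>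
      roundScore p α β γ (E i w.1 w.2) (en i w.1 w.2) a x := by
  have hen : Measurable fun w : (Fin i → Bool × Fin 2) × L => en i w.1 w.2 :=
    measurable_from_prod_countable_right (h.measurable_en i)
  have hlog := (Real.measurable_log.comp (h.measurable_outProb i a x)).div_const (Real.log 2)
  exact Measurable.add (by fun_prop) hlog

protected lemma measurable_history (h : NRoundModel μ A X Λ E en p ωpk ωavg εω) (i : Fin n) :
    Measurable (history (fun i ω => (A i ω, X i ω)) Λ i) :=
  measurable_history (fun j => (h.measurable_A j).prodMk (h.measurable_X j)) h.measurable_Λ i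

lemma isCondLaw_input (h : NRoundModel μ A X Λ E en p ωpk ωavg εω) (i : Fin n) :
    IsCondLaw μ (X i) (history (fun i ω => (A i ω, X i ω)) Λ i)
      fun x _ => ENNReal.ofReal (p x) :=
  isCondLaw_of_condProb_ae_eq (h.measurable_X i)
    (h.measurable_history i)
    (fun _ => measurable_const) (h.input i)

lemma isCondLaw_output (h : NRoundModel μ A X Λ E en p ωpk ωavg εω) (i : Fin n) :
    IsCondLaw μ (A i) (fun ω => (X i ω, history (fun i ω => (A i ω, X i ω)) Λ i ω))
      fun a z => ENNReal.ofReal (outProb (E i z.2.1 z.2.2) a z.1) :=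
  isCondLaw_of_condProb_ae_eq (h.measurable_A i)
    ((h.measurable_X i).prodMk (h.measurable_history i))
    (r := fun a z => outProb (E i z.2.1 z.2.2) a z.1)
    (fun a => measurable_from_prod_countable_right fun x => h.measurable_outProb i a x)
    (h.output i)

lemma isCondLaw_round (h : NRoundModel μ A X Λ E en p ωpk ωavg εω) (hp : ∀ x, 0 ≤ p x)
    (i : Fin n) :
    IsCondLaw μ (fun ω => (A i ω, X i ω)) (history (fun i ω => (A i ω, X i ω)) Λ i)
      fun s w => ENNReal.ofReal (roundLaw p (E i w.1 w.2) s) := by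
  simpa only [roundLaw, ENNReal.ofReal_mul (hp _), mul_comm] using
    (h.isCondLaw_input i).prodMk (h.isCondLaw_output i)

lemma ae_outProb_nonneg (h : NRoundModel μ A X Λ E en p ωpk ωavg εω) (hp : ∀ x, 0 < p x)
    (i : Fin n) :
    ∀ᵐ ω ∂μ, ∀ a x, 0 ≤ outProb (E i (past A X i ω) (Λ ω)) a x := by
  have hactual : ∀ a, ∀ᵐ ω ∂μ, 0 ≤ outProb (E i (past A X i ω) (Λ ω)) a (X i ω) := fun a => by
    filter_upwards [h.output i a] with ω hω
    exact hω ▸ measureReal_nonneg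
  refine ae_all_iff.2 fun a => ?_
  have hall := ((h.isCondLaw_input i).ae_iff (h.measurable_X i)
    (h.measurable_history i)
    (φ := fun x w => 0 ≤ outProb (E i w.1 w.2) a x)
    fun x => measurableSet_le measurable_const (h.measurable_outProb i a x)).1 (hactual a)
  exact hall.mono fun ω hω x => hω x (ENNReal.ofReal_pos.2 (hp x)).ne'

lemma ae_outProb_pos (h : NRoundModel μ A X Λ E en p ωpk ωavg εω) (i : Fin n) :
    ∀ᵐ ω ∂μ, 0 < outProb (E i (past A X i ω) (Λ ω)) (A i ω) (X i ω) :=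
  ((h.isCondLaw_output i).ae_iff (h.measurable_A i)
    ((h.measurable_X i).prodMk (h.measurable_history i))
    (φ := fun a z => 0 < outProb (E i z.2.1 z.2.2) a z.1)
    fun a => measurableSet_lt measurable_const (measurable_from_prod_countable_right
      (f := fun z : Fin 2 × (Fin i → Bool × Fin 2) × L => outProb (E i z.2.1 z.2.2) a z.1)
      fun x => h.measurable_outProb i a x)).2
    (ae_of_all μ fun _ _ ha => ENNReal.ofReal_pos.1 (pos_iff_ne_zero.2 ha))

lemma ae_condProb_eq_prod (h : NRoundModel μ A X Λ E en p ωpk ωavg εω) :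
    ∀ᵐ ω ∂μ, condProb μ (fun ω i => A i ω) (fun ω => (fun i => X i ω, Λ ω)) (fun i => A i ω) ω
      = ∏ i, outProb (E i (past A X i ω) (Λ ω)) (A i ω) (X i ω) := by
  filter_upwards [(isCondLaw_pi h.isCondLaw_input h.isCondLaw_output).condProb_ae_eq
    (measurable_pi_lambda _ h.measurable_A)
    ((measurable_pi_lambda _ h.measurable_X).prodMk h.measurable_Λ),
    ae_all_iff.2 h.ae_outProb_pos] with ω hω hpos
  rw [hω, ENNReal.toReal_prod]
  exact Finset.prod_congr rfl fun i _ => ENNReal.toReal_ofReal (hpos i).le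

lemma ae_bernsteinCondition (h : NRoundModel μ A X Λ E en p ωpk ωavg εω) (hp : ∀ x, 0 < p x)
    (hp1 : ∑ x, p x = 1) (hTF : IsTradeoffFunction p ωpk α β γ) (i : Fin n) :
    ∀ᵐ ω ∂μ, BernsteinCondition (roundLaw p (E i (past A X i ω) (Λ ω)))
      (fun s => roundScore p α β γ (E i (past A X i ω) (Λ ω)) (en i (past A X i ω) (Λ ω)) s.1 s.2)
      √(varBound p α β γ) (xiMax p α β) := by
  filter_upwards [h.quantum i, h.peak i, h.ae_outProb_nonneg hp i] with ω hquantum hpeak hE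
  exact bernsteinCondition_roundLaw hp hp1 hE hTF.1 (hTF.2 _ ⟨hquantum, hpeak⟩)

lemma ae_totalScore_le (h : NRoundModel μ A X Λ E en p ωpk ωavg εω) (hp : ∀ x, 0 < p x)
    (hγ : γ ≤ 0) : ∀ᵐ ω ∂μ, totalScore A X Λ E en p α β γ ω ≤ n * xiMax p α β := by
  filter_upwards [ae_all_iff.2 h.quantum, ae_all_iff.2 (h.ae_outProb_nonneg hp)]
    with ω hquantum hE
  calc totalScore A X Λ E en p α β γ ω ≤ ∑ _i : Fin n, xiMax p α β :=
        Finset.sum_le_sum fun i _ =>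
          roundScore_le_xiMax (hE i) (energy_nonneg_of_mem_quantumSet (hquantum i)) hγ _ _
    _ = n * xiMax p α β := by
        rw [Finset.sum_const, Finset.card_univ, Fintype.card_fin, nsmul_eq_mul]

lemma measureReal_errorTerm_lt_totalScore_le_of_xiMax_nonneg
    (h : NRoundModel μ A X Λ E en p ωpk ωavg εω) (hn : 0 < n) (hp : ∀ x, 0 < p x)
    (hp1 : ∑ x, p x = 1) (hTF : IsTradeoffFunction p ωpk α β γ) (hεt : 0 < εt) (hεt1 : εt ≤ 1)
    (hM : 0 ≤ xiMax p α β) :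
    μ.real {ω | n * errorTerm n p α β γ εt < totalScore A X Λ E en p α β γ ω} ≤ εt := by
  have hn' : (0 : ℝ) < n := Nat.cast_pos.2 hn
  have hlog : 0 ≤ Real.log (1 / εt) := Real.log_nonneg ((one_le_div hεt).2 hεt1)
  have hlogb : Real.log (1 / εt) ≤ Real.logb 2 (1 / εt) :=
    le_div_self hlog (Real.log_pos one_lt_two) (Real.log_two_lt_d9.le.trans (by norm_num))
  set u := Real.logb 2 (1 / εt) / n with hu
  have hu0 : 0 ≤ u := div_nonneg (hlog.trans hlogb) hn'.le
  set r := √(2 * u) with hr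
  have hr2 : r ^ 2 / 2 = u := by
    rw [hr, Real.sq_sqrt (by positivity), mul_div_cancel_left₀ u two_ne_zero]
  have herror : errorTerm n p α β γ εt
      = √(varBound p α β γ) * r + xiMax p α β / 3 * (r ^ 2 / 2) := by
    rw [errorTerm, hr2, ← hu, hr, Real.sqrt_mul zero_le_two, Real.sqrt_mul zero_le_two]
    ring
  rw [herror]
  calc μ.real {ω | n * (√(varBound p α β γ) * r + xiMax p α β / 3 * (r ^ 2 / 2))
        < totalScore A X Λ E en p α β γ ω}
      ≤ Real.exp (-(n * (r ^ 2 / 2))) :=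
        measureReal_mul_lt_sum_le_of_bernsteinCondition (Y := fun i ω => (A i ω, X i ω))
          (P := fun i s w => roundLaw p (E i w.1 w.2) s)
          (f := fun i s w => roundScore p α β γ (E i w.1 w.2) (en i w.1 w.2) s.1 s.2)
          (fun i => (h.measurable_A i).prodMk (h.measurable_X i)) h.measurable_Λ
          (fun i s => h.measurable_roundScore i s.1 s.2) (h.isCondLaw_round fun x => (hp x).le)
          (h.ae_bernsteinCondition hp hp1 hTF) (Real.sqrt_pos.2 (varBound_pos p α β γ)) hM
          (Real.sqrt_nonneg _)
    _ ≤ Real.exp (-Real.log (1 / εt)) := by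
        rw [hr2, hu, mul_div_cancel₀ _ hn'.ne']
        gcongr
    _ = εt := by rw [one_div, Real.log_inv, neg_neg, Real.exp_log hεt]

lemma measureReal_errorTerm_lt_totalScore_le (h : NRoundModel μ A X Λ E en p ωpk ωavg εω)
    (hn : 0 < n) (hp : ∀ x, 0 < p x) (hp1 : ∑ x, p x = 1) (hTF : IsTradeoffFunction p ωpk α β γ)
    (hεt : 0 < εt) (ht : 0 ≤ errorTerm n p α β γ εt) :
    μ.real {ω | n * errorTerm n p α β γ εt < totalScore A X Λ E en p α β γ ω} ≤ εt := by
  rcases le_total 1 εt with hεt1 | hεt1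
  · exact measureReal_le_one.trans hεt1
  rcases le_total 0 (xiMax p α β) with hM | hM
  · exact h.measureReal_errorTerm_lt_totalScore_le_of_xiMax_nonneg hn hp hp1 hTF hεt hεt1 hM
  have hnull : μ {ω | n * errorTerm n p α β γ εt < totalScore A X Λ E en p α β γ ω} = 0 := by
    refine measure_eq_zero_iff_ae_notMem.2 ?_
    filter_upwards [h.ae_totalScore_le hp hTF.1] with ω hω
    exact not_lt.2 (hω.trans (by gcongr; exact hM.trans ht))
  rw [measureReal_def, hnull, ENNReal.toReal_zero]
  exact hεt.le

lemma ae_le_neg_logb_condProb (h : NRoundModel μ A X Λ E en p ωpk ωavg εω) (hn : 0 < n)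
    (hγ : γ ≤ 0) (t : ℝ) :
    ∀ᵐ ω ∂μ, (∀ x, 1 / (n : ℝ) * ∑ i, en i (past A X i ω) (Λ ω) x ≤ ωavg x) →
      totalScore A X Λ E en p α β γ ω ≤ n * t →
      1 / (n : ℝ) * ∑ i, xi p α β (A i ω) (X i ω) + ∑ x, γ x * ωavg x - t
        ≤ -(1 / (n : ℝ)) * Real.logb 2 (condProb μ (fun ω i => A i ω)
          (fun ω => (fun i => X i ω, Λ ω)) (fun i => A i ω) ω) := by
  have hn' : (0 : ℝ) < n := Nat.cast_pos.2 hn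
  filter_upwards [h.ae_condProb_eq_prod, ae_all_iff.2 h.ae_outProb_pos]
    with ω hcond hpos havg hscore
  have henergy : ∑ x, γ x * ωavg x
      ≤ 1 / (n : ℝ) * ∑ i, ∑ x, γ x * en i (past A X i ω) (Λ ω) x := by
    rw [Finset.sum_comm, Finset.mul_sum]
    refine Finset.sum_le_sum fun x _ => ?_
    rw [← Finset.mul_sum, mul_left_comm]
    exact mul_le_mul_of_nonpos_left (havg x) (hγ x)
  have hmean : 1 / (n : ℝ) * totalScore A X Λ E en p α β γ ω ≤ t := by
    rwa [one_div_mul_eq_div, div_le_iff₀' hn']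
  rw [hcond, Real.logb_prod _ _ fun i _ => (hpos i).ne']
  simp only [totalScore, roundScore, Finset.sum_add_distrib, mul_add] at hmean
  linarith

end NRoundModel

end NRounds

end SemiDI

theorem theorem4_general {Ω L : Type*} [MeasurableSpace Ω] [MeasurableSpace L]
    (μ : Measure Ω) [IsProbabilityMeasure μ] {n : ℕ} (hn : 0 < n)
    (A : Fin n → Ω → Bool) (X : Fin n → Ω → Fin 2) (Λ : Ω → L)
    (E en : (i : Fin n) → (Fin i.val → Bool × Fin 2) → L → Fin 2 → ℝ)
    (p ωpk ωavg : Fin 2 → ℝ) (hp : ∀ x, 0 < p x) (hp1 : ∑ x, p x = 1)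
    (εω εt : ℝ) (hεt : 0 < εt)
    (hmodel : SemiDI.NRoundModel μ A X Λ E en p ωpk ωavg εω)
    (α β γ : Fin 2 → ℝ) (hTF : SemiDI.IsTradeoffFunction p ωpk α β γ)
    (ht : 0 ≤ SemiDI.errorTerm n p α β γ εt) :
    1 - εω - εt ≤ μ.real {ω |
      -(1 / (n : ℝ)) * Real.logb 2
          (SemiDI.condProb μ (fun ω i => A i ω) (fun ω => ((fun i => X i ω), Λ ω))
            (fun i => A i ω) ω)
        ≥ (1 / (n : ℝ)) * ∑ i, SemiDI.xi p α β (A i ω) (X i ω)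
          + ∑ x, γ x * ωavg x - SemiDI.errorTerm n p α β γ εt} := by
  let bad := {ω | n * SemiDI.errorTerm n p α β γ εt < SemiDI.totalScore A X Λ E en p α β γ ω}
  let avg := {ω | ∀ x, 1 / (n : ℝ) * ∑ i, en i (SemiDI.past A X i ω) (Λ ω) x ≤ ωavg x}
  have hbad : μ.real bad ≤ εt :=
    hmodel.measureReal_errorTerm_lt_totalScore_le hn hp hp1 hTF hεt ht
  have havg : 1 - εω ≤ μ.real avg := hmodel.average
  refine (sub_le_sub havg hbad).trans (sub_le_iff_le_add.2 ?_)
  refine (ENNReal.toReal_mono (measure_ne_top _ _) (measure_mono_ae ?_)).trans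
    (measureReal_union_le _ bad)
  filter_upwards [hmodel.ae_le_neg_logb_condProb hn hTF.1 (SemiDI.errorTerm n p α β γ εt)]
    with ω hω hω_avg
  exact or_iff_not_imp_right.2 fun hω_bad => hω hω_avg (not_lt.1 hω_bad)

theorem theorem4 {Ω L : Type*} [MeasurableSpace Ω] [MeasurableSpace L]
    (μ : Measure Ω) [IsProbabilityMeasure μ] {n : ℕ} (hn : 0 < n)
    (A : Fin n → Ω → Bool) (X : Fin n → Ω → Fin 2) (Λ : Ω → L)
    (E en : (i : Fin n) → (Fin i.val → Bool × Fin 2) → L → Fin 2 → ℝ)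
    (p ωpk ωavg : Fin 2 → ℝ) (hp : ∀ x, 0 < p x) (hp1 : ∑ x, p x = 1) (hpk : ωpk ≤ 1)
    (εω εt : ℝ) (hεω : 0 ≤ εω) (hεt : 0 < εt)
    (hmodel : SemiDI.NRoundModel μ A X Λ E en p ωpk ωavg εω)
    (α β γ : Fin 2 → ℝ) (hTF : SemiDI.IsTradeoffFunction p ωpk α β γ)
    (ht : 0 ≤ SemiDI.errorTerm n p α β γ εt) :
    1 - εω - εt ≤ μ.real {ω |
      -(1 / (n : ℝ)) * Real.logb 2
          (SemiDI.condProb μ (fun ω i => A i ω) (fun ω => ((fun i => X i ω), Λ ω))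
            (fun i => A i ω) ω)
        ≥ (1 / (n : ℝ)) * ∑ i, SemiDI.xi p α β (A i ω) (X i ω)
          + ∑ x, γ x * ωavg x - SemiDI.errorTerm n p α β γ εt} :=
  theorem4_general μ hn A X Λ E en p ωpk ωavg hp hp1 εω εt hεt hmodel α β γ hTF ht
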